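/- Let $H$ be a real separable Hilbert space with its Borel $\sigma$-algebra. Let $C:H\to H$ be a bounded self-adjoint operator that is non-negative ($\langle Cx,x\rangle\ge 0$ for all $x\in H$; in particular $C$ may be strictly positive) and trace-class ($\sum_i\langle C\phi_i,\phi_i\rangle<\infty$ for every orthonormal basis $(\phi_i)$ of $H$). Let $C^{1/2}$ be the unique non-negative self-adjoint operator with $C^{1/2}C^{1/2}=C$. For $m \in H$, $N(m,C)$ denotes the Gaussian measure on $H$ with mean $m$ and covariance operator $C$. Two measures $\alpha,\beta$ are called equivalent, $\alpha\sim\beta$, if $\alpha\ll\beta$ and $\beta\ll\alpha$. Let $\nu=N(0,C)$, and let $\mu$ be a Borel probability measure on $H$ with $\mu(C^{1/2}(H))=1$. Then: 1. For $\mu$-almost every $u\in H$, the shifted measure $\nu_u(B)=\nu(B-u)$ is the Gaussian $N(u,C)$, and $\nu_u\sim\nu$. 2. The convolution $\nu*\mu$, i.e. the push-forward of $\nu\otimes\mu$ under addition, satisfies $\nu*\mu\sim\nu$. 3. The convolution has a strictly positive density with respect to $\nu$: there is a Borel measurable $\Phi:H\to\mathbb{R}$ such that $\frac{d(\nu*\mu)}{d\nu}(w)=\exp(\Phi(w))$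 for $\nu$-almost every $w \in H$. 4. If $U$ and $\eta$ are independent $H$-valued random variables on a probability space with laws $\mu$ and $\nu$ respectively, then $V=U+\eta$ has law $\nu*\mu$, and for $\mu$-almost every $u$ the regular conditional distribution of $V$ given $U=u$ is $N(u,C)$ and is equivalent to $\nu$. -/

import Mathlib

open MeasureTheory ProbabilityTheory
open scoped RealInnerProductSpace

universe u

/-! ### The non-negative square root of a bounded operator on a real Hilbert space -/

section SquareRoot

/-- The coefficients `a k` for which `√(1 - t) = 1 - t * ∑' k, a k * t ^ k`. -/
noncomputable def sqrtCoeff (k : ℕ) : ℝ := (catalan k : ℝ) * 2 / 4 ^ (k + 1)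

theorem sqrtCoeff_nonneg (k : ℕ) : 0 ≤ sqrtCoeff k := by
  unfold sqrtCoeff
  positivity

theorem sum_sqrtCoeff_mul (n : ℕ) :
    ∑ p ∈ Finset.HasAntidiagonal.antidiagonal n, sqrtCoeff p.1 * sqrtCoeff p.2 = 2 * sqrtCoeff (n + 1) := by
  simp only [sqrtCoeff, catalan_succ', Nat.cast_sum, Nat.cast_mul, Finset.sum_mul, Finset.mul_sum,
    Finset.sum_div]
  refine Finset.sum_congr rfl fun p hp => ?_
  rw [← Finset.HasAntidiagonal.mem_antidiagonal.1 hp]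
  field_simp
  ring

theorem sum_sqrtCoeff_le_one (N : ℕ) : ∑ k ∈ Finset.range N, sqrtCoeff k ≤ 1 := by
  induction N with
  | zero => simp
  | succ N ih =>
    have h0 : sqrtCoeff 0 = 1 / 2 := by norm_num [sqrtCoeff]
    have hn : 0 ≤ ∑ k ∈ Finset.range N, sqrtCoeff k :=
      Finset.sum_nonneg fun k _ => sqrtCoeff_nonneg k
    have h1 : ∑ n ∈ Finset.range N, 2 * sqrtCoeff (n + 1)
        ≤ (∑ k ∈ Finset.range N, sqrtCoeff k) * ∑ k ∈ Finset.range N, sqrtCoeff k := by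
      simp only [← sum_sqrtCoeff_mul]
      rw [Finset.sum_mul_sum, ← Finset.sum_product', Finset.sum_sigma']
      refine le_of_eq_of_le (Finset.sum_image (s := (Finset.range N).sigma
        fun n => Finset.HasAntidiagonal.antidiagonal n) (g := fun x => x.2)
        (f := fun p : ℕ × ℕ => sqrtCoeff p.1 * sqrtCoeff p.2) ?_).symm ?_
      · rintro ⟨n, p⟩ hx ⟨m, q⟩ hy h
        simp only [Finset.coe_sigma, Set.mem_sigma_iff, Finset.mem_coe,
          Finset.HasAntidiagonal.mem_antidiagonal] at hx hy h
        subst h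
        obtain rfl : n = m := hx.2.symm.trans hy.2
        rfl
      · refine Finset.sum_le_sum_of_subset_of_nonneg ?_
          fun p _ _ => mul_nonneg (sqrtCoeff_nonneg _) (sqrtCoeff_nonneg _)
        intro p hp
        simp only [Finset.mem_image, Finset.mem_sigma, Finset.mem_range,
          Finset.HasAntidiagonal.mem_antidiagonal, Finset.mem_product] at hp ⊢
        obtain ⟨⟨n, q⟩, ⟨h1, h2⟩, rfl⟩ := hp
        simp only at h1 h2 ⊢
        omega
    rw [← Finset.mul_sum] at h1
    rw [Finset.sum_range_succ', h0]
    nlinarith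

theorem summable_sqrtCoeff : Summable sqrtCoeff :=
  summable_of_sum_range_le sqrtCoeff_nonneg sum_sqrtCoeff_le_one

/-- The square root of `1 - X` by its binomial series, in a Banach `*`-algebra. -/
theorem exists_sqrt_one_sub_aux {A : Type u} [NormedRing A] [NormedAlgebra ℝ A] [CompleteSpace A]
    [StarRing A] [ContinuousStar A] [StarModule ℝ A] (h1 : ‖(1 : A)‖ ≤ 1) (X : A)
    (hX : star X = X) (hn : ‖X‖ ≤ 1) :
    ∃ Y : A, star Y = Y ∧ ‖Y‖ ≤ 1 ∧ (1 - Y) * (1 - Y) = 1 - X ∧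
      ∀ T : A, Commute T X → Commute T Y := by
  have hpow : ∀ k, ‖X ^ k‖ ≤ 1 := fun k => by
    rcases Nat.eq_zero_or_pos k with rfl | hk
    · simpa using h1
    · exact (norm_pow_le' X hk).trans (pow_le_one₀ (norm_nonneg _) hn)
  have hb : ∀ j k, ‖sqrtCoeff j • X ^ k‖ ≤ sqrtCoeff j := fun j k => by
    rw [norm_smul, Real.norm_of_nonneg (sqrtCoeff_nonneg j)]
    exact mul_le_of_le_one_right (sqrtCoeff_nonneg j) (hpow k)
  have hsn : Summable fun k => ‖sqrtCoeff k • X ^ k‖ :=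
    Summable.of_nonneg_of_le (fun _ => norm_nonneg _) (fun k => hb k k) summable_sqrtCoeff
  have hs : Summable fun k => sqrtCoeff k • X ^ k := hsn.of_norm
  obtain ⟨W, hW⟩ : ∃ W, W = ∑' k, sqrtCoeff k • X ^ k := ⟨_, rfl⟩
  have hWn : ‖W‖ ≤ 1 := by
    rw [hW]
    exact (tsum_of_norm_bounded summable_sqrtCoeff.hasSum (fun k => hb k k)).trans
      (Real.tsum_le_of_sum_range_le sqrtCoeff_nonneg sum_sqrtCoeff_le_one)
  have hcomm : ∀ T : A, Commute T X → Commute T W := fun T hT => by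
    rw [hW]
    exact Commute.tsum_right _ fun k => (hT.pow_right k).smul_right _
  have hWW : W * W = ∑' n, (2 : ℝ) • (sqrtCoeff (n + 1) • X ^ n) := by
    rw [hW, tsum_mul_tsum_eq_tsum_sum_antidiagonal_of_summable_norm hsn hsn]
    refine tsum_congr fun n => ?_
    rw [smul_smul, ← sum_sqrtCoeff_mul, Finset.sum_smul]
    refine Finset.sum_congr rfl fun p hp => ?_
    rw [smul_mul_smul_comm, ← pow_add, Finset.HasAntidiagonal.mem_antidiagonal.1 hp]
  have hs2 : Summable fun n => sqrtCoeff (n + 1) • X ^ n :=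
    Summable.of_norm_bounded ((summable_nat_add_iff 1).2 summable_sqrtCoeff)
      fun k => hb (k + 1) k
  have e : W = (1 / 2 : ℝ) • (1 : A) + ∑' n, sqrtCoeff (n + 1) • X ^ (n + 1) := by
    rw [hW, hs.tsum_eq_zero_add]
    norm_num [sqrtCoeff]
  have e2 : X * (W * W) = (2 : ℝ) • ∑' n, sqrtCoeff (n + 1) • X ^ (n + 1) := by
    rw [hWW, hs2.tsum_const_smul, mul_smul_comm, ← hs2.tsum_mul_left]
    congr 1
    refine tsum_congr fun n => ?_
    rw [mul_smul_comm, ← pow_succ']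
  have hXWW : X * (W * W) = W + W - 1 := by
    rw [e2, ← two_smul ℝ W, e, smul_add, smul_smul]
    norm_num
  have hXW : X * W = W * X := (hcomm X (Commute.refl X)).eq
  have hsW : star W = W := by
    rw [hW, tsum_star]
    refine tsum_congr fun k => ?_
    rw [star_smul, star_pow, hX, star_trivial]
  refine ⟨X * W, ?_, ?_, ?_, fun T hT => hT.mul_right (hcomm T hT)⟩
  · rw [star_mul, hX, hsW, hXW]
  · exact (norm_mul_le _ _).trans (mul_le_one₀ hn (norm_nonneg _) hWn)
  · have h3 : X * W * (X * W) = X * (W + W - 1) := by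
      rw [← hXWW, mul_assoc, ← mul_assoc W X W, ← hXW, mul_assoc X W W]
    rw [sub_mul, mul_sub, mul_sub, h3]
    noncomm_ring

variable {H : Type u} [NormedAddCommGroup H] [InnerProductSpace ℝ H] [CompleteSpace H]

theorem exists_sqrt_one_sub (X : H →L[ℝ] H) (hX : IsSelfAdjoint X) (hn : ‖X‖ ≤ 1) :
    ∃ S : H →L[ℝ] H, S.IsPositive ∧ S * S = 1 - X ∧
      ∀ T : H →L[ℝ] H, Commute T X → Commute T S := by
  obtain ⟨Y, hYs, hYn, hY, hYc⟩ := exists_sqrt_one_sub_aux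
    (A := H →L[ℝ] H) ContinuousLinearMap.norm_id_le X hX.star_eq hn
  refine ⟨1 - Y, ContinuousLinearMap.isPositive_def'.2 ⟨(IsSelfAdjoint.one _).sub hYs,
    fun x => ?_⟩, hY, fun T hT => (Commute.one_right T).sub_right (hYc T hT)⟩
  have h1 : ⟪Y x, x⟫ ≤ ‖x‖ * ‖x‖ :=
    (real_inner_le_norm _ _).trans (mul_le_mul_of_nonneg_right
      ((Y.le_opNorm x).trans (mul_le_of_le_one_left (norm_nonneg _) hYn)) (norm_nonneg _))
  have h2 : ⟪x, x⟫ = ‖x‖ * ‖x‖ := real_inner_self_eq_norm_mul_norm x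
  simp only [ContinuousLinearMap.reApplyInnerSelf_apply, sub_apply,
    one_apply_eq_self, inner_sub_left, RCLike.re_to_real]
  linarith

theorem exists_posSqrt_commute (C : H →L[ℝ] H) (hC : C.IsPositive) :
    ∃ S : H →L[ℝ] H, S.IsPositive ∧ S * S = C ∧
      ∀ T : H →L[ℝ] H, Commute T C → Commute T S := by
  rcases eq_or_ne C 0 with rfl | h0
  · exact ⟨0, hC, by simp, fun T _ => Commute.zero_right T⟩
  have hpos : 0 < ‖C‖ := norm_pos_iff.2 h0
  have hXs : IsSelfAdjoint (1 - ‖C‖⁻¹ • C) :=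
    (IsSelfAdjoint.one _).sub (IsSelfAdjoint.smul (star_trivial _) hC.isSelfAdjoint)
  have hXn : ‖1 - ‖C‖⁻¹ • C‖ ≤ 1 := by
    have hq : ∀ x : H, |⟪(1 - ‖C‖⁻¹ • C) x, x⟫| ≤ ‖x‖ ^ 2 := fun x => by
      have h1 : 0 ≤ ⟪C x, x⟫ := by simpa using hC.re_inner_nonneg_left x
      have h2 : ⟪C x, x⟫ ≤ ‖C‖ * ‖x‖ ^ 2 := by
        refine (real_inner_le_norm _ _).trans ?_
        nlinarith [C.le_opNorm x, norm_nonneg x]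
      have h3 : ‖C‖⁻¹ * ⟪C x, x⟫ ≤ ‖x‖ ^ 2 := by
        rw [inv_mul_le_iff₀ hpos]
        exact h2
      have h4 : 0 ≤ ‖C‖⁻¹ * ⟪C x, x⟫ := by positivity
      simp only [sub_apply, one_apply_eq_self, smul_apply, inner_sub_left,
        real_inner_smul_left, real_inner_self_eq_norm_sq]
      rw [abs_le]
      constructor <;> linarith [sq_nonneg ‖x‖]
    rw [ContinuousLinearMap.norm_eq_iSup_rayleighQuotient _
      (ContinuousLinearMap.isSelfAdjoint_iff_isSymmetric.1 hXs)]
    refine ciSup_le fun x => ?_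
    rw [ContinuousLinearMap.rayleighQuotient, abs_div, abs_of_nonneg (sq_nonneg ‖x‖)]
    exact div_le_one_of_le₀ (hq x) (sq_nonneg _)
  obtain ⟨S, hS, hSS, hSc⟩ := exists_sqrt_one_sub _ hXs hXn
  refine ⟨Real.sqrt ‖C‖ • S, hS.smul_of_nonneg (Real.sqrt_nonneg _), ?_, fun T hT => ?_⟩
  · rw [smul_mul_smul_comm, Real.mul_self_sqrt hpos.le, hSS, sub_sub_cancel, smul_smul,
      mul_inv_cancel₀ hpos.ne', one_smul]
  · exact (hSc T ((Commute.one_right T).sub_right (hT.smul_right _))).smul_right _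

theorem existsUnique_posSqrt (C : H →L[ℝ] H) (hC : C.IsPositive) :
    ∃! S : H →L[ℝ] H, S.IsPositive ∧ S * S = C := by
  obtain ⟨S, hS, hSS, hSc⟩ := exists_posSqrt_commute C hC
  refine ⟨S, ⟨hS, hSS⟩, ?_⟩
  rintro T ⟨hT, hTT⟩
  have hTS : T * S = S * T := (hSc T (by rw [← hTT]; exact (Commute.refl T).mul_right rfl)).eq
  have hDsa : IsSelfAdjoint (T - S) := hT.isSelfAdjoint.sub hS.isSelfAdjoint
  have hDs : (T - S).IsSymmetric :=
    ContinuousLinearMap.isSelfAdjoint_iff_isSymmetric.1 hDsa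
  have hprod : (T + S) * (T - S) = 0 := by
    rw [add_mul, mul_sub, mul_sub, hTT, hSS, hTS]
    abel
  have hD3 : ∀ x, ⟪(T - S) ((T - S) x), (T - S) x⟫ = 0 := fun x => by
    have h1 : 0 ≤ ⟪T ((T - S) x), (T - S) x⟫ := by
      simpa using hT.re_inner_nonneg_left ((T - S) x)
    have h2 : 0 ≤ ⟪S ((T - S) x), (T - S) x⟫ := by
      simpa using hS.re_inner_nonneg_left ((T - S) x)
    have h3 : T ((T - S) x) + S ((T - S) x) = 0 := by
      simpa using congrArg (fun A : H →L[ℝ] H => A x) hprod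
    have h4 : ⟪T ((T - S) x), (T - S) x⟫ + ⟪S ((T - S) x), (T - S) x⟫ = 0 := by
      rw [← inner_add_left, h3, inner_zero_left]
    rw [sub_apply (f := T) (g := S), inner_sub_left]
    linarith
  set D : H →L[ℝ] H := T - S with hD
  have hz : ((D ^ 3 : H →L[ℝ] H) : H →ₗ[ℝ] H) = 0 := by
    refine (ContinuousLinearMap.isSelfAdjoint_iff_isSymmetric.1
      (hDsa.pow 3)).inner_map_self_eq_zero.1 fun x => ?_
    have h1 : ⟪D (D (D x)), x⟫ = ⟪D (D x), D x⟫ := hDs _ _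
    exact h1.trans (hD3 x)
  have hz' : ∀ x, D (D (D x)) = 0 := fun x => LinearMap.congr_fun hz x
  have hz2 : ∀ x, D (D x) = 0 := fun x => by
    have h1 : ⟪D (D (D x)), D x⟫ = ⟪D (D x), D (D x)⟫ := hDs _ _
    rw [hz', inner_zero_left] at h1
    exact inner_self_eq_zero.1 h1.symm
  have hz1 : D = 0 := ContinuousLinearMap.ext fun x => by
    have h1 : ⟪D (D x), x⟫ = ⟪D x, D x⟫ := hDs _ _
    rw [hz2, inner_zero_left] at h1
    exact inner_self_eq_zero.1 h1.symm
  exact sub_eq_zero.1 hz1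

/-- `C^{1/2}`: the unique non-negative self-adjoint operator `S` with `S * S = C`. -/
noncomputable def posSqrt (C : H →L[ℝ] H) (hC : C.IsPositive) : H →L[ℝ] H :=
  (existsUnique_posSqrt C hC).choose

theorem posSqrt_isPositive (C : H →L[ℝ] H) (hC : C.IsPositive) : (posSqrt C hC).IsPositive :=
  (existsUnique_posSqrt C hC).choose_spec.1.1

theorem posSqrt_mul_self (C : H →L[ℝ] H) (hC : C.IsPositive) :
    posSqrt C hC * posSqrt C hC = C :=
  (existsUnique_posSqrt C hC).choose_spec.1.2

end SquareRoot

/-! ### Trace-class operators, Gaussian measures, equivalence of measures -/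

/-- A self-adjoint non-negative operator is trace-class if its diagonal is summable along every
orthonormal basis. -/
def IsTraceClass {H : Type u} [NormedAddCommGroup H] [InnerProductSpace ℝ H]
    (C : H →L[ℝ] H) : Prop :=
  ∀ (ι : Type u) (b : HilbertBasis ι ℝ H), Summable fun i => ⟪C (b i), b i⟫

/-- `γ = N(m, C)`: the measure `γ` is Gaussian with mean `m` and covariance operator `C`. -/
structure IsGaussianLaw {H : Type u} [NormedAddCommGroup H] [InnerProductSpace ℝ H]
    [CompleteSpace H] [MeasurableSpace H] [BorelSpace H]
    (γ : Measure H) (m : H) (C : H →L[ℝ] H) : Prop where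
  isGaussian : IsGaussian γ
  mean_eq : ∫ x, x ∂γ = m
  covariance_eq : ∀ x y : H, covarianceBilin γ x y = ⟪C x, y⟫

/-- Equivalence of measures: mutual absolute continuity. -/
def MeasureEquivalent {X : Type*} [MeasurableSpace X] (μ ν : Measure X) : Prop :=
  μ.AbsolutelyContinuous ν ∧ ν.AbsolutelyContinuous μ

/-!
The heart of the matter is the Cameron-Martin theorem in its qualitative form: if `ν = N(0, C)` and
`u` lies in the range of `C^{1/2}`, then the shift of `ν` by `u` is absolutely continuous with
respect to `ν`. Applied to `-u` as well, this gives equivalence.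

For `u = C y` the shifted measure is the exponential tilt of `ν` by `⟪y, ·⟫`
(`IsGaussianLaw.tilted_inner`); both sides have the same exponential moments, and these determine a
measure (`MeasureTheory.Measure.ext_of_integral_exp_inner`). The density has second moment
`exp ⟪C y, y⟫ = exp (‖C^{1/2} y‖ ^ 2)`, so by the Cauchy-Schwarz inequality the shifted measure of a
set `s` is at most `exp (‖C^{1/2} y‖ ^ 2 / 2) * ν s ^ (1/2)` (`IsGaussianLaw.map_add_apply_le`).
This bound involves `y` only through `‖C^{1/2} y‖`, hence it survives a limit. A general
`u = C^{1/2} v` may be written with `v` in the closure of the range of `C^{1/2}`, so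
`C^{1/2} (y n) → v` for some sequence `y`, and then `C (y n) → u`. Fatou's lemma carries the bound
to `u` on open sets, and outer regularity of `ν` turns it into absolute continuity
(`IsGaussianLaw.map_add_absolutelyContinuous_of_tendsto`).

The range of `C^{1/2}` is Borel, being the injective continuous image of the orthogonal complement
of the kernel, so `μ`-almost every `u` lies in it. By Fubini the convolution is the `μ`-mixture of
the shifted measures, and is therefore equivalent to `ν` (`MeasureEquivalent.conv_of_ae`); its
Radon-Nikodym density is almost everywhere positive and finite, so it has a logarithm. Finally, the
kernel of shifts disintegrates the joint law of `U` and `U + η` (`condDistrib_add_ae_eq`).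
-/

/-! ### Exponential moments and shifts of Gaussian measures -/

section Gaussian

variable {H : Type*} [NormedAddCommGroup H] [InnerProductSpace ℝ H] [CompleteSpace H]
  [MeasurableSpace H] [BorelSpace H]

namespace IsGaussianLaw

variable {γ : Measure H} {m : H} {C : H →L[ℝ] H}

theorem inner_comm (h : IsGaussianLaw γ m C) (x y : H) : ⟪C x, y⟫ = ⟪C y, x⟫ := by
  rw [← h.covariance_eq, ← h.covariance_eq, covarianceBilin_comm]

theorem inner_self_nonneg (h : IsGaussianLaw γ m C) (t : H) : 0 ≤ ⟪C t, t⟫ := by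
  rw [← h.covariance_eq]
  exact covarianceBilin_self_nonneg t

end IsGaussianLaw

variable [SecondCountableTopology H]

/-- Finite exponential moments determine a measure: along each direction they extend analytically to
the complex moment-generating function, whose value at `I` is the characteristic function. -/
theorem MeasureTheory.Measure.ext_of_integral_exp_inner {α β : Measure H}
    [IsProbabilityMeasure α] [IsProbabilityMeasure β]
    (hα : ∀ t : H, Integrable (fun x => Real.exp ⟪t, x⟫) α)
    (h : ∀ t : H, ∫ x, Real.exp ⟪t, x⟫ ∂α = ∫ x, Real.exp ⟪t, x⟫ ∂β) : α = β := by
  refine Measure.ext_of_charFun (funext fun t => ?_)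
  have hmgf : mgf (fun x => ⟪t, x⟫) α = mgf (fun x => ⟪t, x⟫) β := by
    funext s
    simpa only [mgf, real_inner_smul_left] using h (s • t)
  have huniv : integrableExpSet (fun x => ⟪t, x⟫) α = Set.univ :=
    Set.eq_univ_of_forall fun s => by
      simpa only [integrableExpSet, Set.mem_ofPred_eq, real_inner_smul_left] using hα (s • t)
  have key := eqOn_complexMGF_of_mgf hmgf (x := Complex.I) (by simp [huniv])
  simpa only [complexMGF, charFun_apply, mul_comm Complex.I, real_inner_comm t] using key

namespace IsGaussianLaw

variable {γ : Measure H} {m : H} {C : H →L[ℝ] H}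

theorem map_inner (h : IsGaussianLaw γ m C) (t : H) :
    γ.map (fun x => ⟪t, x⟫) = gaussianReal ⟪t, m⟫ ⟪C t, t⟫.toNNReal := by
  have := h.isGaussian
  have h1 := IsGaussian.map_eq_gaussianReal (μ := γ) (innerSL ℝ t)
  rw [IsGaussian.integral_dual, h.mean_eq] at h1
  have h2 := covarianceBilin_self (μ := γ) IsGaussian.memLp_two_id t
  rw [h.covariance_eq] at h2
  rw [h2]
  exact h1

theorem integrable_exp_inner (h : IsGaussianLaw γ m C) (t : H) :
    Integrable (fun x => Real.exp ⟪t, x⟫) γ := by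
  have h1 := integrable_exp_mul_gaussianReal (μ := ⟪t, m⟫) (v := ⟪C t, t⟫.toNNReal) 1
  rw [← h.map_inner t, integrable_map_measure (by fun_prop) (by fun_prop)] at h1
  simpa [Function.comp_def] using h1

theorem integral_exp_inner (h : IsGaussianLaw γ m C) (t : H) :
    ∫ x, Real.exp ⟪t, x⟫ ∂γ = Real.exp (⟪t, m⟫ + ⟪C t, t⟫ / 2) := by
  have h1 := mgf_gaussianReal (h.map_inner t) 1
  simpa [mgf, Real.coe_toNNReal _ (h.inner_self_nonneg t)] using h1

theorem map_add_const (h : IsGaussianLaw γ m C) (u : H) :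
    IsGaussianLaw (γ.map (fun x => x + u)) (m + u) C := by
  have := h.isGaussian
  refine ⟨inferInstance, ?_, fun x y => ?_⟩
  · rw [integral_map (by fun_prop) (by fun_prop),
      integral_add IsGaussian.integrable_fun_id (integrable_const u), h.mean_eq]
    simp
  · simp_rw [add_comm _ u]
    rw [covarianceBilin_map_const_add, h.covariance_eq]

/-- Tilting a Gaussian measure by the linear functional `⟪y, ·⟫` shifts it by `C y`. -/
theorem tilted_inner (h : IsGaussianLaw γ m C) (y : H) :
    γ.tilted (fun x => ⟪y, x⟫) = γ.map (fun x => x + C y) := by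
  have := h.isGaussian
  have := isProbabilityMeasure_tilted (h.integrable_exp_inner y)
  have hs := h.map_add_const (C y)
  have := hs.isGaussian
  symm
  refine Measure.ext_of_integral_exp_inner hs.integrable_exp_inner fun t => ?_
  rw [hs.integral_exp_inner, integral_exp_tilted, h.integral_exp_inner]
  have h1 : (fun x => Real.exp (((fun x => ⟪y, x⟫) + fun x => ⟪t, x⟫) x))
      = fun x => Real.exp ⟪y + t, x⟫ := by
    funext x
    simp [inner_add_left]
  rw [h1, h.integral_exp_inner, ← Real.exp_sub]
  congr 1
  simp only [map_add, inner_add_left, inner_add_right, h.inner_comm t y, real_inner_comm (C y) t]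
  ring

/-- The density of the shift by `C y` has second moment `exp ⟪C y, y⟫`, so that the
Cauchy-Schwarz inequality controls the shifted measure by `γ`. -/
theorem map_add_apply_le (h : IsGaussianLaw γ 0 C) (y : H) {s : Set H} (hs : MeasurableSet s) :
    γ.map (fun x => x + C y) s
      ≤ γ s ^ (1 / 2 : ℝ) * ENNReal.ofReal (Real.exp (⟪C y, y⟫ / 2)) := by
  have := h.isGaussian
  set Z := ∫ x, Real.exp ⟪y, x⟫ ∂γ with hZ
  have hZe : Z = Real.exp (⟪C y, y⟫ / 2) := by simp [hZ, h.integral_exp_inner]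
  -- The squared density is again an exponential of a linear functional, with `y` doubled.
  have hsq : ∀ x, (ENNReal.ofReal (Real.exp ⟪y, x⟫ / Z)) ^ (2 : ℝ)
      = ENNReal.ofReal (Real.exp ⟪(2 : ℝ) • y, x⟫ * Real.exp (-⟪C y, y⟫)) := fun x => by
    rw [hZe, ← Real.exp_sub, ← Real.exp_add, ENNReal.ofReal_rpow_of_pos (Real.exp_pos _),
      ← Real.exp_mul, real_inner_smul_left]
    ring_nf
  have hint : ∫⁻ x, (ENNReal.ofReal (Real.exp ⟪y, x⟫ / Z)) ^ (2 : ℝ) ∂γ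
      = ENNReal.ofReal (Real.exp ⟪C y, y⟫) := by
    simp_rw [hsq]
    rw [← ofReal_integral_eq_lintegral_ofReal ((h.integrable_exp_inner _).mul_const _)
      (ae_of_all _ fun x => by positivity), integral_mul_const, h.integral_exp_inner,
      ← Real.exp_add]
    simp only [map_smul, real_inner_smul_left, real_inner_smul_right, inner_zero_right]
    ring_nf
  have hind : ∫⁻ x, (s.indicator (fun _ => (1 : ENNReal)) x) ^ (2 : ℝ) ∂γ = γ s := by
    rw [← lintegral_indicator_one hs]
    refine lintegral_congr fun x => ?_
    by_cases hx : x ∈ s <;> simp [hx]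
  rw [← h.tilted_inner y, tilted_apply' _ _ hs, ← lintegral_indicator hs]
  calc _ = ∫⁻ x, (s.indicator (fun _ => (1 : ENNReal))
        * fun x => ENNReal.ofReal (Real.exp ⟪y, x⟫ / Z)) x ∂γ := by
        refine lintegral_congr fun x => ?_
        by_cases hx : x ∈ s <;> simp [hx, hZ]
    _ ≤ _ := ENNReal.lintegral_mul_le_Lp_mul_Lq γ Real.HolderConjugate.two_two
        ((measurable_const.indicator hs).aemeasurable) (by fun_prop)
    _ = _ := by
        rw [hind, hint, ENNReal.ofReal_rpow_of_pos (Real.exp_pos _), ← Real.exp_mul]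
        ring_nf

/-- The Cauchy-Schwarz bound for the shifts by `C (y n)` passes to the limiting shift on open sets
by Fatou's lemma, and to null sets by outer regularity. -/
theorem map_add_absolutelyContinuous_of_tendsto (h : IsGaussianLaw γ 0 C) {u : H} {y : ℕ → H}
    (hu : Filter.Tendsto (fun n => C (y n)) Filter.atTop (nhds u)) {K : ℝ}
    (hK : ∀ n, ⟪C (y n), y n⟫ ≤ K) : γ.map (fun x => x + u) ≪ γ := by
  have := h.isGaussian
  set c := ENNReal.ofReal (Real.exp (K / 2))
  have hopen : ∀ G, IsOpen G → γ.map (fun x => x + u) G ≤ γ G ^ (1 / 2 : ℝ) * c := fun G hG => by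
    have hind : Measurable (G.indicator fun _ => (1 : ENNReal)) :=
      measurable_const.indicator hG.measurableSet
    calc γ.map (fun x => x + u) G
        = ∫⁻ x, G.indicator (fun _ => 1) (x + u) ∂γ := by
          rw [← lintegral_indicator_one hG.measurableSet,
            lintegral_map (by exact hind) (by fun_prop)]
          rfl
      _ ≤ ∫⁻ x, Filter.liminf (fun n => G.indicator (fun _ => 1) (x + C (y n)))
            Filter.atTop ∂γ := by
          refine lintegral_mono fun x => ?_
          -- The indicator of an open set is lower semicontinuous.
          by_cases hx : x + u ∈ G
          · refine Filter.le_liminf_of_le (by isBoundedDefault) ?_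
            filter_upwards [(hu.const_add x).eventually (hG.mem_nhds hx)] with n hn
            have hn' : x + C (y n) ∈ G := hn
            simp [hx, hn']
          · simp [hx]
      _ ≤ Filter.liminf (fun n => ∫⁻ x, G.indicator (fun _ => 1) (x + C (y n)) ∂γ) Filter.atTop :=
          lintegral_liminf_le fun n => hind.comp (by fun_prop)
      _ ≤ γ G ^ (1 / 2 : ℝ) * c := by
          refine Filter.liminf_le_of_le (by isBoundedDefault) fun b hb => ?_
          obtain ⟨n, hn⟩ := hb.exists
          refine hn.trans ?_
          calc _ = γ.map (fun x => x + C (y n)) G := by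
                rw [← lintegral_indicator_one hG.measurableSet,
                  lintegral_map (by exact hind) (by fun_prop)]
                rfl
            _ ≤ _ := h.map_add_apply_le (y n) hG.measurableSet
            _ ≤ _ := by
                have hKn := hK n
                simp only [c]
                gcongr
  intro s hs
  by_contra hne
  have hlim : Filter.Tendsto (fun r : ENNReal => r ^ (1 / 2 : ℝ) * c) (nhds 0) (nhds 0) := by
    have := ENNReal.Tendsto.mul_const (b := c)
      ((ENNReal.continuous_rpow_const (y := 1 / 2)).tendsto 0) (Or.inr ENNReal.ofReal_ne_top)
    simpa using this
  obtain ⟨r, hr0, hr⟩ : ∃ r : ENNReal, 0 < r ∧ r ^ (1 / 2 : ℝ) * c < γ.map (fun x => x + u) s := by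
    have h1 := (hlim.eventually (gt_mem_nhds (pos_iff_ne_zero.2 hne))).filter_mono
      (nhdsWithin_le_nhds (s := Set.Ioi 0))
    obtain ⟨r, hr, hr'⟩ := (h1.and self_mem_nhdsWithin).exists
    exact ⟨r, hr', hr⟩
  obtain ⟨G, hsG, hG, hGr⟩ := s.exists_isOpen_lt_of_lt (μ := γ) r (hs ▸ hr0)
  refine absurd hr (not_lt.2 ?_)
  calc _ ≤ γ.map (fun x => x + u) G := measure_mono hsG
    _ ≤ γ G ^ (1 / 2 : ℝ) * c := hopen G hG
    _ ≤ r ^ (1 / 2 : ℝ) * c := by gcongr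

end IsGaussianLaw
end Gaussian

/-! ### The range of a self-adjoint operator -/

section Range

variable {H : Type*} [NormedAddCommGroup H] [InnerProductSpace ℝ H] [CompleteSpace H]

/-- Every value of a self-adjoint operator is attained on the closure of its range, which is the
orthogonal complement of its kernel. -/
theorem ContinuousLinearMap.exists_mem_closure_range_apply_eq {S : H →L[ℝ] H}
    (hS : IsSelfAdjoint S) (v : H) :
    ∃ w ∈ closure (Set.range S), w ∈ S.kerᗮ ∧ S w = S v := by
  have : CompleteSpace S.ker := S.isClosed_ker.completeSpace_coe
  obtain ⟨k, hk, w, hw, rfl⟩ := S.ker.exists_add_mem_mem_orthogonal v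
  refine ⟨w, ?_, hw, ?_⟩
  · have h1 := hw
    rw [S.orthogonal_ker, hS.adjoint_eq] at h1
    exact h1
  · have hk0 : S k = 0 := hk
    rw [map_add, hk0, zero_add]

/-- The operator is injective on the orthogonal complement of its kernel, so the Lusin-Souslin
theorem applies. -/
theorem ContinuousLinearMap.measurableSet_range_of_isSelfAdjoint [SecondCountableTopology H]
    [MeasurableSpace H] [BorelSpace H] {S : H →L[ℝ] H} (hS : IsSelfAdjoint S) :
    MeasurableSet (Set.range S) := by
  have h1 : Set.range S = S '' (S.kerᗮ : Set H) := by
    refine Set.Subset.antisymm ?_ (Set.image_subset_range _ _)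
    rintro _ ⟨v, rfl⟩
    obtain ⟨w, -, hw, h⟩ := S.exists_mem_closure_range_apply_eq hS v
    exact ⟨w, hw, h⟩
  rw [h1]
  refine S.ker.isClosed_orthogonal.measurableSet.image_of_continuousOn_injOn
    S.continuous.continuousOn fun x hx y hy hxy => ?_
  have h2 : x - y ∈ S.ker := by
    rw [LinearMap.mem_ker]
    simpa [sub_eq_zero] using hxy
  exact sub_eq_zero.1
    (inner_self_eq_zero.1 (S.kerᗮ.sub_mem hx hy (x - y) h2))

end Range

/-! ### Equivalence of shifted Gaussian measures -/

section CameronMartin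

variable {H : Type*} [NormedAddCommGroup H] [InnerProductSpace ℝ H] [CompleteSpace H]
  [SecondCountableTopology H] [MeasurableSpace H] [BorelSpace H]

namespace IsGaussianLaw

variable {γ : Measure H} {C : H →L[ℝ] H}

/-- Absolute continuity in the Cameron-Martin theorem. Writing `u = C^{1/2} w` with `w` in the
closure of the range of `C^{1/2}`, any `y n` with `C^{1/2} (y n) → w` have `C (y n) → u` while
`⟪C (y n), y n⟫ = ‖C^{1/2} (y n)‖ ^ 2` stays bounded. -/
theorem map_add_absolutelyContinuous (h : IsGaussianLaw γ 0 C) (hC : C.IsPositive) {u : H}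
    (hu : u ∈ Set.range (posSqrt C hC)) : γ.map (fun x => x + u) ≪ γ := by
  set S := posSqrt C hC
  have hS : IsSelfAdjoint S := (posSqrt_isPositive C hC).isSelfAdjoint
  have hSS : ∀ x, S (S x) = C x := fun x =>
    congrArg (fun A : H →L[ℝ] H => A x) (posSqrt_mul_self C hC)
  obtain ⟨v, rfl⟩ := hu
  obtain ⟨w, hw, -, hwv⟩ := S.exists_mem_closure_range_apply_eq hS v
  obtain ⟨z, hz, hzw⟩ := mem_closure_iff_seq_limit.1 hw
  choose y hy using hz
  have hSy : Filter.Tendsto (fun n => S (y n)) Filter.atTop (nhds w) := by simpa only [hy] using hzw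
  obtain ⟨K, hK⟩ := hSy.norm.bddAbove_range
  refine h.map_add_absolutelyContinuous_of_tendsto (y := y) (K := K ^ 2) ?_ fun n => ?_
  · rw [← hwv]
    simpa only [Function.comp_def, hSS] using (S.continuous.tendsto w).comp hSy
  · have h1 : ⟪C (y n), y n⟫ = ‖S (y n)‖ ^ 2 := by
      rw [← hSS, ← real_inner_self_eq_norm_sq]
      exact ContinuousLinearMap.isSelfAdjoint_iff_isSymmetric.1 hS _ _
    rw [h1]
    have h2 : ‖S (y n)‖ ≤ K := hK ⟨n, rfl⟩
    gcongr

theorem measureEquivalent_map_add (h : IsGaussianLaw γ 0 C) (hC : C.IsPositive) {u : H}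
    (hu : u ∈ Set.range (posSqrt C hC)) : MeasureEquivalent (γ.map (fun x => x + u)) γ := by
  refine ⟨h.map_add_absolutelyContinuous hC hu, ?_⟩
  have hneg : -u ∈ Set.range (posSqrt C hC) := by
    obtain ⟨v, rfl⟩ := hu
    exact ⟨-v, map_neg _ _⟩
  -- Shifting `γ.map (· + -u) ≪ γ` by `u` gives the reverse relation.
  have h1 := (h.map_add_absolutelyContinuous hC hneg).map (f := fun x => x + u) (by fun_prop)
  rw [Measure.map_map (by fun_prop) (by fun_prop)] at h1
  simpa [Function.comp_def] using h1

end IsGaussianLaw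
end CameronMartin

/-! ### Convolutions, densities and conditional laws -/

section Convolution

theorem MeasureEquivalent.conv_of_ae {G : Type*} [AddCommMonoid G] [MeasurableSpace G]
    [MeasurableAdd₂ G] {ν μ : Measure G} [SFinite ν] [IsProbabilityMeasure μ]
    (h : ∀ᵐ u ∂μ, MeasureEquivalent (ν.map (fun x => x + u)) ν) :
    MeasureEquivalent (ν.conv μ) ν := by
  have key : ∀ s, MeasurableSet s →
      ν.conv μ s = ∫⁻ u, ν.map (fun x => x + u) s ∂μ := fun s hs => by
    rw [Measure.conv, Measure.map_apply (by fun_prop) hs,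
      Measure.prod_apply_symm (measurable_add hs)]
    refine lintegral_congr fun u => ?_
    rw [Measure.map_apply (by fun_prop) hs]
    rfl
  refine ⟨Measure.AbsolutelyContinuous.mk fun s hs h0 => ?_,
    Measure.AbsolutelyContinuous.mk fun s hs h0 => ?_⟩
  · rw [key s hs]
    refine lintegral_eq_zero_of_ae_eq_zero ?_
    filter_upwards [h] with u hu using hu.1 h0
  · rw [key s hs, lintegral_eq_zero_iff'] at h0
    · -- A single shift that is equivalent to `ν` and vanishes on `s` suffices.
      obtain ⟨u, hu, hu0⟩ := (h.and h0).exists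
      exact hu.2 hu0
    · have h1 := measurable_measure_prodMk_right (μ := ν) (measurable_add hs)
      exact h1.aemeasurable.congr (ae_of_all _ fun u =>
        (Measure.map_apply (f := fun x => x + u) (by fun_prop) hs).symm)

theorem MeasureEquivalent.exists_exp_density {X : Type*} [MeasurableSpace X] {α β : Measure X}
    [SigmaFinite α] [SigmaFinite β] (h : MeasureEquivalent α β) :
    ∃ Φ : X → ℝ, Measurable Φ ∧
      α = β.withDensity fun x => ENNReal.ofReal (Real.exp (Φ x)) := by
  refine ⟨fun x => Real.log (α.rnDeriv β x).toReal, by fun_prop, ?_⟩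
  conv_lhs => rw [← Measure.withDensity_rnDeriv_eq α β h.1]
  refine withDensity_congr_ae ?_
  filter_upwards [h.2.ae_le (Measure.rnDeriv_pos h.1), Measure.rnDeriv_lt_top α β] with x h0 htop
  rw [Real.exp_log (ENNReal.toReal_pos h0.ne' htop.ne), ENNReal.ofReal_toReal htop.ne]

/-- Given `U = u`, the sum of `U` and an independent `η` is distributed as `η + u`. -/
theorem condDistrib_add_ae_eq {G Ω : Type*} [AddCommMonoid G] [MeasurableSpace G]
    [MeasurableAdd₂ G] [StandardBorelSpace G] [Nonempty G] [MeasurableSpace Ω] {P : Measure Ω}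
    [IsProbabilityMeasure P] {U η : Ω → G} (hU : AEMeasurable U P) (hη : AEMeasurable η P)
    (hind : IndepFun U η P) :
    ∀ᵐ u ∂P.map U, condDistrib (fun ω => U ω + η ω) U P u = (P.map η).map (fun x => x + u) := by
  have := Measure.isProbabilityMeasure_map hU
  have := Measure.isProbabilityMeasure_map hη
  let κ : Kernel G G :=
    (Kernel.id ×ₖ Kernel.const G (P.map η)).map fun p : G × G => p.1 + p.2
  have hκ : ∀ u, κ u = (P.map η).map (fun x => x + u) := fun u => by
    simp only [κ]
    rw [Kernel.map_apply _ (by fun_prop), Kernel.prod_apply, Kernel.id_apply, Kernel.const_apply,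
      Measure.dirac_prod, Measure.map_map (by fun_prop) (by fun_prop)]
    simp only [Function.comp_def, add_comm]
  have h1 : condDistrib (fun ω => U ω + η ω) U P =ᵐ[P.map U] κ := by
    refine condDistrib_ae_eq_of_measure_eq_compProd U (by fun_prop) ?_
    have h2 := (indepFun_iff_map_prod_eq_prod_map_map hU hη).1 hind
    have h3 : P.map (fun ω => (U ω, U ω + η ω))
        = ((P.map U).prod (P.map η)).map fun p => (p.1, p.1 + p.2) := by
      rw [← h2, AEMeasurable.map_map_of_aemeasurable (by fun_prop) (by fun_prop)]
      rfl
    rw [h3]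
    ext s hs
    rw [Measure.map_apply (by fun_prop) hs, Measure.prod_apply (hs.preimage (by fun_prop)),
      Measure.compProd_apply hs]
    refine lintegral_congr fun u => ?_
    rw [hκ, Measure.map_apply (by fun_prop) (hs.preimage (by fun_prop))]
    simp only [Set.preimage, Set.mem_ofPred_eq, add_comm]
  filter_upwards [h1] with u hu
  rw [hu, hκ]

end Convolution

theorem mainTheorem1 {H : Type*} [NormedAddCommGroup H] [InnerProductSpace ℝ H]
    [CompleteSpace H] [SecondCountableTopology H] [MeasurableSpace H] [BorelSpace H]
    (C : H →L[ℝ] H) (hC : C.IsPositive) (hCtr : IsTraceClass C)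
    (ν μ : Measure H) (hν : IsGaussianLaw ν 0 C) [IsProbabilityMeasure μ]
    (hμ : μ (Set.range (posSqrt C hC)) = 1) :
    -- the shifted Gaussians `N(u, C)` are equivalent to `ν`
    (∀ᵐ u ∂μ, IsGaussianLaw (ν.map (fun x => x + u)) u C ∧
      MeasureEquivalent (ν.map (fun x => x + u)) ν) ∧
    -- the convolution is equivalent to `ν`
    MeasureEquivalent (ν.conv μ) ν ∧
    -- the convolution has a strictly positive density `exp Φ` with respect to `ν`
    (∃ Φ : H → ℝ, Measurable Φ ∧
      ν.conv μ = ν.withDensity (fun w => ENNReal.ofReal (Real.exp (Φ w)))) ∧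
    -- for independent `U ∼ μ` and `η ∼ ν`, the law of `V = U + η` is the convolution, and the
    -- conditional law of `V` given `U = u` is `N(u, C)` and is equivalent to `ν`
    (∀ (Ω : Type*) [MeasurableSpace Ω] (P : Measure Ω) [IsProbabilityMeasure P]
      (U η : Ω → H), HasLaw U μ P → HasLaw η ν P → IndepFun U η P →
        P.map (fun ω => U ω + η ω) = ν.conv μ ∧
        ∀ᵐ u ∂μ, IsGaussianLaw (condDistrib (fun ω => U ω + η ω) U P u) u C ∧
          MeasureEquivalent (condDistrib (fun ω => U ω + η ω) U P u) ν) := by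
  have := hν.isGaussian
  have hrange : ∀ᵐ u ∂μ, u ∈ Set.range (posSqrt C hC) :=
    (prob_compl_eq_zero_iff (ContinuousLinearMap.measurableSet_range_of_isSelfAdjoint
      (posSqrt_isPositive C hC).isSelfAdjoint)).2 hμ
  have hshift : ∀ᵐ u ∂μ, IsGaussianLaw (ν.map (fun x => x + u)) u C ∧
      MeasureEquivalent (ν.map (fun x => x + u)) ν := by
    filter_upwards [hrange] with u hu
    exact ⟨by simpa using hν.map_add_const u, hν.measureEquivalent_map_add hC hu⟩
  have hconv : MeasureEquivalent (ν.conv μ) ν :=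
    MeasureEquivalent.conv_of_ae (hshift.mono fun _ hu => hu.2)
  refine ⟨hshift, hconv, hconv.exists_exp_density, fun Ω _ P _ U η hU hη hind => ⟨?_, ?_⟩⟩
  · rw [Measure.conv_comm, ← hU.map_eq, ← hη.map_eq]
    exact hind.map_add_eq_map_conv_map₀ hU.aemeasurable hη.aemeasurable
  · have h1 := condDistrib_add_ae_eq hU.aemeasurable hη.aemeasurable hind
    rw [hU.map_eq, hη.map_eq] at h1
    filter_upwards [h1, hshift] with u hu hs
    rwa [hu]
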